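/- Let $r\ge 0$, $S=\mathbb N^r\setminus\{0\}$, and let $\langle-,-\rangle$ be a skew-symmetric bilinear form $\mathbb Z^r\times\mathbb Z^r\to\mathbb Z$. Let $\mathcal R=\bigoplus_{\gamma\in\mathbb N^r}\mathcal R_\gamma$ be a graded associative unital $\mathbb Q$-algebra such that, for $\gamma,\gamma'\in S$, $\langle\gamma,\gamma'\rangle=0$ implies $[\mathcal R_\gamma,\mathcal R_{\gamma'}]=0$. Let $A:S\to\mathcal R$ be a map with $A(\gamma)\in\mathcal R_\gamma$ for all $\gamma\in S$. A function $F:\bigcup_{n\ge1}S^n\to\mathbb Q$ (a collection) acts on a map $H:S\to\mathcal R$ by $$(F*H)(\gamma)=\sum_{n\ge1}\ \sum_{\alpha\in S^n,\ \alpha_1+\dots+\alpha_n=\gamma}F(\alpha)\,H(\alpha_1)\cdots H(\alpha_n),\qquad\gamma\in S.$$ For $\theta\in\mathbb R^r$ and $a\in S$ put $\mu_\theta(a)=\sum_k\theta_ka_k\big/\sum_ka_k$. The stacky invariants $A_\theta:S\to\mathcal R$ are defined recursively by $$A(\gamma)=\sum_{\alpha_1+\dots+\alpha_n=\gamma,\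 \mu_\theta(\alpha_1)>\dots>\mu_\theta(\alpha_n)}A_\theta(\alpha_1)\cdots A_\theta(\alpha_n),\qquad\gamma\in S,$$ and the rational invariants are $\bar A_\theta=\mathbf{log}_\theta*A_\theta$, where, for $\alpha\in S^n$, $\mathbf{log}_\theta(\alpha)=\frac{(-1)^{n-1}}n$ if $\mu_\theta(\alpha_1)=\dots=\mu_\theta(\alpha_n)$ and $\mathbf{log}_\theta(\alpha)=0$ otherwise. The parameter $\theta$ is called generic if, for all $a,b\in S$, $\mu_\theta(a)=\mu_\theta(b)$ implies $ma=nb$ for some integers $m,n\ge1$. For $\gamma\in S$, the rational attractor invariant $\bar A_*(\gamma)$ is the value $\bar A_{\theta'}(\gamma)$ for a generic perturbation $\theta'$ of $\langle-,\gamma\rangle\in\operatorname{Hom}(\mathbb Z^r,\mathbb R)\cong\mathbb R^r$, that is, for any generic $\theta'$ sufficiently close (depending on $\gamma$) to $\langle-,\gamma\rangle$. The attractor collection $g_*$ is defined, for $\alpha\in S^n$, with $\alpha_{\le k}=\alpha_1+\dots+\alpha_k$ and $\alpha_{>k}=\alpha_{k+1}+\dots+\alpha_n$, by $$g_*(\alpha)=\begin{cases}\dfrac{(-1)^{n-1}}{n_0+1}&\text{if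 }\langle\alpha_{\le k},\alpha_{>k}\rangle\ge0\text{ for all }1\le k<n,\\[1ex]0&\text{otherwise,}\end{cases}$$ where $n_0$ is the number of $1\le k<n$ with $\langle\alpha_{\le k},\alpha_{>k}\rangle=0$. Theorem. For every $\gamma\in S$, there are generic $\theta'$ arbitrarily close to $\langle-,\gamma\rangle$, and $\bar A_{\theta'}(\gamma)$ is the same for all generic $\theta'$ close enough to $\langle-,\gamma\rangle$, so that $\bar A_*$ is well defined; and $$\bar A_*=g_**A.$$ -/

import Mathlib

open Filter Topology

namespace AttractorDT

/-- The semigroup `S = ℕ^r \ {0}`. -/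
abbrev S (r : ℕ) : Type := {γ : Fin r → ℕ // γ ≠ 0}

/-- The total degree `δ · γ = γ_1 + ... + γ_r`. -/
def size {r : ℕ} (γ : Fin r → ℕ) : ℕ := ∑ i, γ i

/-- The sum `|α| = α_1 + ... + α_n` of a tuple of elements of `S`, as an element of `ℕ^r`. -/
def total {r : ℕ} (α : List (S r)) : Fin r → ℕ := (α.map Subtype.val).sum

theorem size_add {r : ℕ} (a b : Fin r → ℕ) : size (a + b) = size a + size b := by
  simp [size, Finset.sum_add_distrib]

theorem size_pos {r : ℕ} (a : S r) : 0 < size a.1 := by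
  rcases Nat.eq_zero_or_pos (size a.1) with h | h
  · exfalso
    apply a.2
    funext i
    simpa using (Finset.sum_eq_zero_iff.mp h) i (Finset.mem_univ i)
  · exact h

theorem total_cons {r : ℕ} (a : S r) (α : List (S r)) : total (a :: α) = a.1 + total α := by
  simp [total]

/-- Every element of `ℕ^r` is a sum of elements of `S` in finitely many ways only. -/
theorem finite_tuples {r : ℕ} (γ : Fin r → ℕ) : {α : List (S r) | total α = γ}.Finite := by
  induction h : size γ using Nat.strong_induction_on generalizing γ with
  | _ N ih =>
    have key : {α : List (S r) | total α = γ} ⊆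
        {[]} ∪ ⋃ a ∈ {a : S r | a.1 ≤ γ}, (List.cons a) '' {α | total α = γ - a.1} := by
      intro α hα
      cases α with
      | nil => simp
      | cons a β =>
        right
        have e : a.1 + total β = γ := by rw [← total_cons]; exact hα
        simp only [Set.mem_iUnion]
        refine ⟨a, ?_, β, ?_, rfl⟩
        · change a.1 ≤ γ
          rw [← e]; exact le_self_add
        · change total β = γ - a.1
          rw [← e]; simp
    refine Set.Finite.subset (Set.Finite.union (Set.finite_singleton _)
      (Set.Finite.biUnion ?_ ?_)) key
    · exact Set.Finite.preimage Subtype.val_injective.injOn (Set.finite_Iic γ)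
    · intro a ha
      refine Set.Finite.image _ (ih (size (γ - a.1)) ?_ _ rfl)
      have h1 : size γ = size (γ - a.1) + size a.1 := by
        rw [← size_add, tsub_add_cancel_of_le (show a.1 ≤ γ from ha)]
      have h2 := size_pos a
      omega

/-- The finite set of all tuples `α ∈ S^n`, `n ≥ 1`, with `|α| = γ`. -/
noncomputable def tuples {r : ℕ} (γ : S r) : Finset (List (S r)) := (finite_tuples γ.1).toFinset

theorem mem_tuples {r : ℕ} {γ : S r} {α : List (S r)} : α ∈ tuples γ ↔ total α = γ.1 := by
  simp [tuples]

/-- A member of a decomposition of `γ` other than the trivial one `(γ)` is smaller than `γ`. -/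
theorem size_lt_of_mem {r : ℕ} {γ x : S r} {α : List (S r)} (hα : α ∈ tuples γ)
    (hne : α ≠ [γ]) (hx : x ∈ α) : size x.1 < size γ.1 := by
  classical
  rw [mem_tuples] at hα
  have hp : (x :: α.erase x).Perm α := (List.perm_cons_erase hx).symm
  have ht : x.1 + total (α.erase x) = γ.1 := by
    rw [← total_cons, ← hα]
    exact (hp.map Subtype.val).sum_eq
  cases hβ : α.erase x with
  | nil =>
    exfalso
    rw [hβ] at hp ht
    have h1 : α = [x] := (List.singleton_perm.mp hp).symm
    have h2 : x = γ := Subtype.ext (by simpa [total] using ht)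
    exact hne (by rw [h1, h2])
  | cons y β =>
    rw [hβ, total_cons] at ht
    have h1 := size_pos y
    rw [← ht, size_add, size_add]
    omega

/-- Rational collections: functions on the tuples of elements of `S`. Only non-empty tuples
matter, as the empty one is not a decomposition of any element of `S`. -/
abbrev Collection (r : ℕ) : Type := List (S r) → ℚ

section Algebra

variable {r : ℕ} {R : Type*} [Ring R] [Algebra ℚ R]

/-- The action of a collection `F` on a `1`-collection `H`:
`(F * H)(γ) = ∑_{|α| = γ} F(α) H(α_1) ⋯ H(α_n)`. -/
noncomputable def act (F : Collection r) (H : S r → R) (γ : S r) : R :=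
  ∑ α ∈ tuples γ, F α • (α.map H).prod

end Algebra

/-- The slope `μ_θ(a) = (∑ θ_k a_k) / (∑ a_k)`; the weak stability `a ≤_θ b` is
`slope θ a ≤ slope θ b`. -/
noncomputable def slope {r : ℕ} (θ : Fin r → ℝ) (a : S r) : ℝ :=
  (∑ k, θ k * (a.1 k : ℝ)) / (∑ k, (a.1 k : ℝ))

open Classical in
/-- The Harder-Narasimhan collection `s_θ`: it is `1` if `α_1 >_θ ⋯ >_θ α_n`, and `0` otherwise. -/
noncomputable def hnCollection {r : ℕ} (θ : Fin r → ℝ) : Collection r := fun α =>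
  if α.IsChain (fun a b => slope θ b < slope θ a) then 1 else 0

open Classical in
/-- The logarithmic collection `log_θ`: it is `(-1)^(n-1) / n` if `α_1 ∼_θ ⋯ ∼_θ α_n`, and `0`
otherwise. -/
noncomputable def logCollection {r : ℕ} (θ : Fin r → ℝ) : Collection r := fun α =>
  if α.IsChain (fun a b => slope θ a = slope θ b) then
    (-1 : ℚ) ^ (α.length - 1) / (α.length : ℚ) else 0

section Invariants

variable {r : ℕ} {R : Type*} [Ring R] [Algebra ℚ R]

/-- The stacky invariants `A_θ`, obtained by solving the basic wall-crossing formula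
`A(γ) = ∑_{|α| = γ, α_1 >_θ ⋯ >_θ α_n} A_θ(α_1) ⋯ A_θ(α_n)` recursively
(see `act_hnCollection_stacky`). -/
noncomputable def stacky (θ : Fin r → ℝ) (A : S r → R) (γ : S r) : R :=
  A γ - ∑ α ∈ ((tuples γ).erase [γ]).attach,
    hnCollection θ α.1 • (α.1.attach.map (fun x => stacky θ A x.1)).prod
termination_by size γ.1
decreasing_by
  exact size_lt_of_mem (Finset.mem_of_mem_erase α.2) (Finset.ne_of_mem_erase α.2) x.2

/-- The basic wall-crossing formula `A = s_θ * A_θ`. -/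
theorem act_hnCollection_stacky (θ : Fin r → ℝ) (A : S r → R) :
    act (hnCollection θ) (stacky θ A) = A := by
  classical
  funext γ
  have hmem : [γ] ∈ tuples γ := by simp [mem_tuples, total]
  have h1 : hnCollection θ [γ] = 1 := by simp [hnCollection]
  rw [act, ← Finset.add_sum_erase _ _ hmem, h1]
  simp only [List.map_cons, List.map_nil, List.prod_singleton, one_smul]
  conv_lhs => enter [1]; rw [stacky]
  rw [← Finset.sum_attach ((tuples γ).erase [γ])]
  simp

/-- The rational invariants `log_θ * A_θ` of the stability `θ`. -/
noncomputable def rational (θ : Fin r → ℝ) (A : S r → R) : S r → R :=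
  act (logCollection θ) (stacky θ A)

end Invariants

/-- Proportional elements: `m a = n b` for some `m, n ≥ 1`. -/
def Proportional {r : ℕ} (a b : S r) : Prop :=
  ∃ m n : ℕ, 1 ≤ m ∧ 1 ≤ n ∧ m • a.1 = n • b.1

/-- The set of generic stability parameters: `a ∼_θ b` only for proportional `a, b ∈ S`. -/
def genericStabilities (r : ℕ) : Set (Fin r → ℝ) :=
  {θ | ∀ a b : S r, slope θ a = slope θ b → Proportional a b}

/-- The inclusion `ℕ^r ⊆ ℤ^r`. -/
def toLattice {r : ℕ} (a : Fin r → ℕ) : Fin r → ℤ := fun i => (a i : ℤ)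

/-- The self-stability `θ = ⟨-, γ⟩`, written in coordinates: `θ_k = ⟨e_k, γ⟩`. -/
def selfStability {r : ℕ} (ω : LinearMap.BilinForm ℤ (Fin r → ℤ)) (γ : S r) : Fin r → ℝ :=
  fun k => ((ω (Pi.single k 1) (toLattice γ.1) : ℤ) : ℝ)

/-- The filter of generic perturbations of the self-stability of `γ`: a property holds along it if
it holds for all generic `θ'` that are close enough to `⟨-, γ⟩`. -/
def attractorFilter {r : ℕ} (ω : LinearMap.BilinForm ℤ (Fin r → ℤ)) (γ : S r) :
    Filter (Fin r → ℝ) :=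
  𝓝[genericStabilities r] (selfStability ω γ)

open Classical in
/-- The rational attractor invariant of `γ`: the common value at `γ` of the rational invariants
of all generic `θ'` close enough to `⟨-, γ⟩` (and `0` if there were no such common value). -/
noncomputable def attractorRational {r : ℕ} {R : Type*} [Ring R] [Algebra ℚ R]
    (ω : LinearMap.BilinForm ℤ (Fin r → ℤ)) (A : S r → R) (γ : S r) : R :=
  if h : ∃ x : R, ∀ᶠ θ' in attractorFilter ω γ, rational θ' A γ = x then h.choose else 0

/-- The number `⟨α_{≤k}, α_{>k}⟩`. -/
def cutPairing {r : ℕ} (ω : LinearMap.BilinForm ℤ (Fin r → ℤ)) (α : List (S r)) (k : ℕ) : ℤ :=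
  ω (toLattice (total (α.take k))) (toLattice (total (α.drop k)))

open Classical in
/-- The attractor collection `g_*`: it is `(-1)^(n-1) / (n_0 + 1)` if `⟨α_{≤k}, α_{>k}⟩ ≥ 0` for
all `1 ≤ k < n`, and `0` otherwise; here `n_0` is the number of `1 ≤ k < n` with
`⟨α_{≤k}, α_{>k}⟩ = 0`. -/
noncomputable def attractorCollection {r : ℕ} (ω : LinearMap.BilinForm ℤ (Fin r → ℤ)) :
    Collection r := fun α =>
  if ∀ k ∈ Finset.Ico 1 α.length, 0 ≤ cutPairing ω α k then
    (-1 : ℚ) ^ (α.length - 1) /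
      (((Finset.Ico 1 α.length).filter (fun k => cutPairing ω α k = 0)).card + 1 : ℚ)
  else 0

end AttractorDT

namespace AttractorDT

/-! ### Cutting and rotating tuples -/

section Splitting

variable {r : ℕ}

/-! Put ψ(a) = ∑ (θ_k - μ_θ(γ)) a_k. For every θ, the rational invariant at γ is the sum of
A-products over the tuples with ψ(α_{≤k}) ≥ 0 at all cuts, weighted by a sign over one plus the
number of zeros (`rational_eq_act_cutCollection`). Indeed, substituting A = s_θ * A_θ makes this a
claim about rational coefficients: each cut is either a descent of the slope or an outer cut, the
two options carry opposite signs, and since ψ(γ) = 0 only `log_θ` survives.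

For θ = ⟨-, γ⟩ these weights are g_*, because ⟨α_{≤k}, γ⟩ = ⟨α_{≤k}, α_{>k}⟩. It remains to pass to
a nearby θ' with its function ψ' (`act_cutCollection_eq`). By a cycle lemma
(`sum_zeroWeight_rotate`) the unsigned weights of the rotations of a tuple add up to 1, for ψ and
for ψ'. Multiplying each weight by the other's rotation sum turns both sides into sums over tuples
and their rotations. A term with ψ-weight on α and ψ'-weight on its rotation at k survives only if
ψ(α_{≤k}) = 0; then the two pieces pair to zero, their products commute, and rotating changes
nothing.

This gives the equality for every θ' near ⟨-, γ⟩; density of the generic ones (Baire) makes the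
common value unique. -/

theorem total_nil : total ([] : List (S r)) = 0 := rfl

theorem total_append (α β : List (S r)) : total (α ++ β) = total α + total β := by
  simp [total]

theorem total_take_add_total_drop (α : List (S r)) (k : ℕ) :
    total (α.take k) + total (α.drop k) = total α := by
  rw [← total_append, List.take_append_drop]

theorem total_ne_zero {α : List (S r)} (h : α ≠ []) : total α ≠ 0 := by
  obtain ⟨a, l, rfl⟩ := List.exists_cons_of_ne_nil h
  intro h0
  have h1 := congrArg size h0
  rw [total_cons, size_add] at h1
  have := size_pos a
  simp only [size, Pi.zero_apply, Finset.sum_const_zero] at h1 this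
  omega

theorem ne_nil_of_mem_tuples {γ : S r} {α : List (S r)} (h : α ∈ tuples γ) : α ≠ [] := by
  rintro rfl
  exact γ.2 (mem_tuples.mp h).symm

/-- The decompositions of `γ` into an ordered pair of elements of `S`. -/
noncomputable def pairs (γ : S r) : Finset (S r × S r) :=
  (((Finset.Iic γ.1).preimage Subtype.val Subtype.val_injective.injOn) ×ˢ
    ((Finset.Iic γ.1).preimage Subtype.val Subtype.val_injective.injOn)).filter
    (fun p => p.1.1 + p.2.1 = γ.1)

theorem mem_pairs {γ : S r} {p : S r × S r} : p ∈ pairs γ ↔ p.1.1 + p.2.1 = γ.1 := by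
  simp only [pairs, Finset.mem_filter, Finset.mem_product, Finset.mem_preimage, Finset.mem_Iic,
    and_iff_right_iff_imp]
  intro h
  rw [← h]
  exact ⟨le_self_add, le_add_self⟩

/-- Summing over the cuts of all tuples is the same as summing over pairs of tuples. -/
theorem sum_pairs_tuples {M : Type*} [AddCommMonoid M] (γ : S r)
    (φ : List (S r) → List (S r) → M) :
    ∑ p ∈ pairs γ, ∑ α ∈ tuples p.1, ∑ β ∈ tuples p.2, φ α β =
      ∑ α ∈ tuples γ, ∑ k ∈ Finset.Ico 1 α.length, φ (α.take k) (α.drop k) := by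
  simp_rw [← Finset.sum_product']
  rw [Finset.sum_sigma', Finset.sum_sigma']
  refine Finset.sum_bij' (fun x _ => ⟨x.2.1 ++ x.2.2, x.2.1.length⟩)
    (fun x hx => ⟨(⟨total (x.1.take x.2), total_ne_zero ?_⟩, ⟨total (x.1.drop x.2),
      total_ne_zero ?_⟩), (x.1.take x.2, x.1.drop x.2)⟩) ?_ ?_ ?_ ?_ ?_
  · simp only [Finset.mem_sigma, Finset.mem_Ico] at hx
    rw [← List.length_pos_iff, List.length_take]
    omega
  · simp only [Finset.mem_sigma, Finset.mem_Ico] at hx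
    rw [← List.length_pos_iff, List.length_drop]
    omega
  · rintro ⟨⟨a, b⟩, α, β⟩ hx
    simp only [Finset.mem_sigma, Finset.mem_product, mem_pairs] at hx
    have h1 := List.length_pos_iff.mpr (ne_nil_of_mem_tuples hx.2.1)
    have h2 := List.length_pos_iff.mpr (ne_nil_of_mem_tuples hx.2.2)
    simp only [Finset.mem_sigma, mem_tuples, total_append, Finset.mem_Ico, List.length_append]
    rw [mem_tuples.mp hx.2.1, mem_tuples.mp hx.2.2]
    exact ⟨hx.1, by omega, by omega⟩
  · rintro ⟨α, k⟩ hx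
    simp only [Finset.mem_sigma, mem_tuples] at hx
    simp [mem_pairs, mem_tuples, total_take_add_total_drop, hx.1]
  · rintro ⟨⟨a, b⟩, α, β⟩ hx
    simp only [Finset.mem_sigma, Finset.mem_product, mem_tuples] at hx
    obtain ⟨-, h1, h2⟩ := hx
    have e1 : (⟨total α, by rw [h1]; exact a.2⟩ : S r) = a := Subtype.ext h1
    have e2 : (⟨total β, by rw [h2]; exact b.2⟩ : S r) = b := Subtype.ext h2
    simp [e1, e2]
  · rintro ⟨α, k⟩ hx
    simp only [Finset.mem_sigma, Finset.mem_Ico] at hx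
    have : min k α.length = k := by omega
    simp [this]
  · rintro ⟨⟨a, b⟩, α, β⟩ hx
    simp

theorem sum_pairs_swap {M : Type*} [AddCommMonoid M] (γ : S r) (f : S r × S r → M) :
    ∑ p ∈ pairs γ, f p = ∑ p ∈ pairs γ, f p.swap := by
  refine Finset.sum_bij' (fun p _ => p.swap) (fun p _ => p.swap) ?_ ?_ ?_ ?_ ?_ <;>
    simp +contextual [mem_pairs, add_comm]

/-- The sum over all cuts of all tuples may be taken over the rotated tuples. -/
theorem sum_tuples_swap {M : Type*} [AddCommMonoid M] (γ : S r)
    (φ : List (S r) → List (S r) → M) :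
    ∑ α ∈ tuples γ, ∑ k ∈ Finset.Ico 1 α.length, φ (α.take k) (α.drop k) =
      ∑ α ∈ tuples γ, ∑ k ∈ Finset.Ico 1 α.length, φ (α.drop k) (α.take k) := by
  rw [← sum_pairs_tuples γ φ, ← sum_pairs_tuples γ (fun u v => φ v u), sum_pairs_swap]
  exact Finset.sum_congr rfl fun p _ => Finset.sum_comm

end Splitting

/-! ### Peeling off the first entry of a tuple -/

section Composition

variable {r : ℕ} {R : Type*} [Ring R] [Algebra ℚ R]

theorem sum_tuples_eq_add_pairs {M : Type*} [AddCommMonoid M] (γ : S r) (f : List (S r) → M) :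
    ∑ α ∈ tuples γ, f α =
      f [γ] + ∑ p ∈ pairs γ, ∑ β ∈ tuples p.2, f (p.1 :: β) := by
  classical
  have hmem : [γ] ∈ tuples γ := by simp [mem_tuples, total]
  rw [← Finset.add_sum_erase _ _ hmem, Finset.sum_sigma']
  congr 1
  symm
  refine Finset.sum_bij (fun x _ => x.1.1 :: x.2) ?_ ?_ ?_ ?_
  · rintro ⟨⟨a, b⟩, β⟩ hx
    simp only [Finset.mem_sigma, mem_pairs] at hx
    have h2 := ne_nil_of_mem_tuples hx.2
    simp only [Finset.mem_erase, mem_tuples, total_cons]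
    refine ⟨by simp [h2], by rw [mem_tuples.mp hx.2]; exact hx.1⟩
  · rintro ⟨⟨a, b⟩, β⟩ hx ⟨⟨a', b'⟩, β'⟩ hx' h
    simp only [Finset.mem_sigma, mem_tuples] at hx hx'
    simp only [List.cons.injEq] at h
    obtain ⟨rfl, rfl⟩ := h
    have : b = b' := Subtype.ext (hx.2.symm.trans hx'.2)
    simp [this]
  · intro α hα
    simp only [Finset.mem_erase, mem_tuples] at hα
    obtain ⟨hne, ht⟩ := hα
    cases α with
    | nil => exact absurd ht.symm γ.2
    | cons a β =>
      have hβ : β ≠ [] := by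
        rintro rfl
        exact hne (by rw [show a = γ from Subtype.ext (by simpa [total] using ht)])
      refine ⟨⟨(a, ⟨total β, total_ne_zero hβ⟩), β⟩, ?_, rfl⟩
      simp [mem_pairs, mem_tuples, ← total_cons, ht]
  · intros; rfl

theorem act_eq_add_pairs (F : Collection r) (H : S r → R) (γ : S r) :
    act F H γ = F [γ] • H γ + ∑ p ∈ pairs γ, H p.1 * act (fun l => F (p.1 :: l)) H p.2 := by
  rw [act, sum_tuples_eq_add_pairs]
  simp [act, Finset.mul_sum]

theorem size_lt_of_mem_pairs {γ : S r} {p : S r × S r} (h : p ∈ pairs γ) :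
    size p.2.1 < size γ.1 := by
  rw [mem_pairs] at h
  rw [← h, size_add]
  have := size_pos p.1
  omega

end Composition

/-! ### Cut collections and their recursion -/

section CutCollection

variable {r : ℕ}

open Classical in
/-- The collection of a linear function `ψ`, an offset `y` and a number `j` of zeros seen before:
it is `(-1)^(n-1) / (n_0 + j + 1)` if `y + ψ(α_{≤k}) ≥ 0` for all `1 ≤ k < n`, where `n_0` is the
number of zeros among these numbers, and `0` otherwise. -/
noncomputable def cutCollection (ψ : (Fin r → ℕ) →+ ℝ) (y : ℝ) (j : ℕ) : Collection r := fun α =>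
  if ∀ k ∈ Finset.Ico 1 α.length, 0 ≤ y + ψ (total (α.take k)) then
    (-1 : ℚ) ^ (α.length - 1) /
      (((Finset.Ico 1 α.length).filter (fun k => y + ψ (total (α.take k)) = 0)).card + j + 1 : ℚ)
  else 0

theorem cutCollection_singleton (ψ : (Fin r → ℕ) →+ ℝ) (y : ℝ) (j : ℕ) (a : S r) :
    cutCollection ψ y j [a] = 1 / (j + 1 : ℚ) := by
  simp [cutCollection]

-- Removing the first entry moves it into the offset and its cut into the zero counter; the offset
-- and counter exist to make this recursion close.
open Classical in
theorem cutCollection_cons (ψ : (Fin r → ℕ) →+ ℝ) (y : ℝ) (j : ℕ) (a : S r) {l : List (S r)}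
    (hl : l ≠ []) :
    cutCollection ψ y j (a :: l) = if 0 ≤ y + ψ a.1 then
      -cutCollection ψ (y + ψ a.1) (j + if y + ψ a.1 = 0 then 1 else 0) l else 0 := by
  have hlen := List.length_pos_iff.mpr hl
  have key : ∀ k, y + ψ (total ((a :: l).take (k + 1))) = y + ψ a.1 + ψ (total (l.take k)) := by
    intro k
    rw [List.take_succ_cons, total_cons, map_add, add_assoc]
  have hall : (∀ k ∈ Finset.Ico 1 (a :: l).length, 0 ≤ y + ψ (total ((a :: l).take k))) ↔
      0 ≤ y + ψ a.1 ∧ ∀ k ∈ Finset.Ico 1 l.length, 0 ≤ y + ψ a.1 + ψ (total (l.take k)) := by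
    constructor
    · intro h
      refine ⟨?_, fun k hk => ?_⟩
      · simpa [total] using h 1 (by simpa using hlen)
      · rw [← key]
        exact h (k + 1) (by simp at hk ⊢; omega)
    · rintro ⟨h1, h2⟩ k hk
      obtain ⟨k, rfl⟩ : ∃ k', k = k' + 1 := ⟨k - 1, by simp at hk; omega⟩
      rw [key]
      rcases Nat.eq_zero_or_pos k with rfl | hk0
      · simpa [total_nil] using h1
      · exact h2 k (by simp at hk ⊢; omega)
  have hcard : ((Finset.Ico 1 (a :: l).length).filter
      (fun k => y + ψ (total ((a :: l).take k)) = 0)).card =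
      (if y + ψ a.1 = 0 then 1 else 0) + ((Finset.Ico 1 l.length).filter
      (fun k => y + ψ a.1 + ψ (total (l.take k)) = 0)).card := by
    rw [Finset.card_filter, Finset.card_filter, List.length_cons,
      Finset.sum_eq_sum_Ico_succ_bot (by omega), ← Finset.sum_Ico_add' _ 1 l.length 1]
    simp_rw [key]
    simp [total]
  unfold cutCollection
  simp only [hall, hcard]
  by_cases h : 0 ≤ y + ψ a.1
  · simp only [h, true_and, if_true]
    obtain ⟨m, hm⟩ : ∃ m, l.length = m + 1 := ⟨l.length - 1, by omega⟩
    by_cases h2 : ∀ k ∈ Finset.Ico 1 l.length, 0 ≤ y + ψ a.1 + ψ (total (l.take k))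
    · rw [if_pos h2, if_pos h2]
      simp only [hm, List.length_cons, Nat.add_sub_cancel, pow_succ]
      push_cast
      ring
    · rw [if_neg h2, if_neg h2, neg_zero]
  · simp [h]

end CutCollection

/-! ### Cancellation down to the logarithmic collection -/

section Merged

variable {r : ℕ}

/-- The linear function `a ↦ ∑ (θ_k - μ) a_k`, whose sign compares the slope of `a` with `μ`. -/
noncomputable def stabilityHom (θ : Fin r → ℝ) (μ : ℝ) : (Fin r → ℕ) →+ ℝ where
  toFun a := ∑ k, (θ k - μ) * (a k : ℝ)
  map_zero' := by simp
  map_add' a b := by simp [mul_add, Finset.sum_add_distrib]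

theorem stabilityHom_apply (θ : Fin r → ℝ) (μ : ℝ) (a : Fin r → ℕ) :
    stabilityHom θ μ a = ∑ k, (θ k - μ) * (a k : ℝ) := rfl

theorem sum_cast_pos (a : S r) : (0 : ℝ) < ∑ k, (a.1 k : ℝ) := by
  have := size_pos a
  rw [size] at this
  exact_mod_cast this

theorem stabilityHom_eq (θ : Fin r → ℝ) (μ : ℝ) (a : S r) :
    stabilityHom θ μ a.1 = (slope θ a - μ) * ∑ k, (a.1 k : ℝ) := by
  have := (sum_cast_pos a).ne'
  rw [stabilityHom_apply, slope, sub_mul, div_mul_cancel₀ _ this]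
  simp [sub_mul, Finset.sum_sub_distrib, Finset.mul_sum]

theorem stabilityHom_pos_iff {θ : Fin r → ℝ} {μ : ℝ} {a : S r} :
    0 < stabilityHom θ μ a.1 ↔ μ < slope θ a := by
  rw [stabilityHom_eq, mul_pos_iff_of_pos_right (sum_cast_pos a), sub_pos]

theorem stabilityHom_eq_zero_iff {θ : Fin r → ℝ} {μ : ℝ} {a : S r} :
    stabilityHom θ μ a.1 = 0 ↔ slope θ a = μ := by
  rw [stabilityHom_eq, mul_eq_zero, or_iff_left (sum_cast_pos a).ne', sub_eq_zero]

theorem stabilityHom_neg_iff {θ : Fin r → ℝ} {μ : ℝ} {a : S r} :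
    stabilityHom θ μ a.1 < 0 ↔ slope θ a < μ := by
  rw [stabilityHom_eq, ← neg_pos, ← neg_mul, mul_pos_iff_of_pos_right (sum_cast_pos a), neg_pos,
    sub_neg]

open Classical in
/-- The collection obtained by composing `cutCollection` with the Harder-Narasimhan collection:
every cut is either a descent of the slope, or a cut of the outer tuple. -/
noncomputable def mergedCollection (θ : Fin r → ℝ) (μ : ℝ) : ℝ → ℕ → Collection r
  | _, _, [] => 0
  | _, j, [_] => 1 / (j + 1 : ℚ)
  | y, j, a :: b :: l =>
    (if slope θ b < slope θ a then
      mergedCollection θ μ (y + stabilityHom θ μ a.1) j (b :: l) else 0) +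
    if 0 ≤ y + stabilityHom θ μ a.1 then
      -mergedCollection θ μ (y + stabilityHom θ μ a.1)
        (j + if y + stabilityHom θ μ a.1 = 0 then 1 else 0) (b :: l) else 0

theorem hnCollection_singleton (θ : Fin r → ℝ) (a : S r) : hnCollection θ [a] = 1 := by
  simp [hnCollection]

open Classical in
theorem hnCollection_cons_cons (θ : Fin r → ℝ) (a b : S r) (l : List (S r)) :
    hnCollection θ (a :: b :: l) =
      (if slope θ b < slope θ a then 1 else 0) * hnCollection θ (b :: l) := by
  simp only [hnCollection, List.isChain_cons_cons]
  split_ifs <;> simp_all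

open Classical in
/-- Expansion of the composed collection along the first cut of the outer tuple. -/
theorem mergedCollection_eq_sum (θ : Fin r → ℝ) (μ : ℝ) (y : ℝ) (j : ℕ) {α : List (S r)}
    (hα : α ≠ []) :
    mergedCollection θ μ y j α = hnCollection θ α / (j + 1 : ℚ) +
      ∑ k ∈ Finset.Ico 1 α.length, hnCollection θ (α.take k) *
        if 0 ≤ y + stabilityHom θ μ (total (α.take k)) then
          -mergedCollection θ μ (y + stabilityHom θ μ (total (α.take k)))
            (j + if y + stabilityHom θ μ (total (α.take k)) = 0 then 1 else 0) (α.drop k)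
        else 0 := by
  match α with
  | [] => exact absurd rfl hα
  | [a] => simp [mergedCollection, hnCollection_singleton]
  | a :: b :: l =>
    have hsum : ∀ f : ℕ → ℚ, ∑ k ∈ Finset.Ico 1 (a :: b :: l).length, f k =
        f 1 + ∑ k ∈ Finset.Ico 1 (b :: l).length, f (k + 1) := by
      intro f
      rw [List.length_cons (a := a), Finset.sum_eq_sum_Ico_succ_bot (by simp),
        ← Finset.sum_Ico_add' _ 1 (b :: l).length 1]
    rw [mergedCollection, mergedCollection_eq_sum θ μ _ j (List.cons_ne_nil b l),
      hnCollection_cons_cons, hsum]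
    have key : ∀ k ∈ Finset.Ico 1 (b :: l).length,
        hnCollection θ ((a :: b :: l).take (k + 1)) =
        (if slope θ b < slope θ a then 1 else 0) * hnCollection θ ((b :: l).take k) := by
      intro k hk
      obtain ⟨k, rfl⟩ : ∃ k', k = k' + 1 := ⟨k - 1, by simp at hk; omega⟩
      simp [hnCollection_cons_cons]
    conv_rhs => rw [Finset.sum_congr rfl fun k hk => by rw [key k hk]]
    simp only [List.take_succ_cons, List.drop_succ_cons, total_cons, map_add, ← add_assoc,
      List.take_zero, List.drop_zero, total_nil, add_zero, hnCollection_singleton,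
      one_mul, mul_assoc, ← Finset.mul_sum]
    by_cases h : slope θ b < slope θ a
    · simp only [h, if_true, one_mul]
      ring
    · simp [h]
termination_by α.length

/-- After `a` the offset is positive, so an outer cut is allowed and adds no zero. At a descent the
two options cancel. Otherwise the next slope is still above μ, and this cannot persist to the end,
where the offset must be 0. -/
theorem mergedCollection_eq_zero_of_pos (θ : Fin r → ℝ) (μ : ℝ) (l : List (S r)) :
    ∀ (y : ℝ) (j : ℕ) (a : S r), 0 ≤ y → μ < slope θ a →
      y + stabilityHom θ μ (total (a :: l)) = 0 → mergedCollection θ μ y j (a :: l) = 0 := by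
  induction l with
  | nil =>
    intro y j a hy ha h
    have := stabilityHom_pos_iff.mpr ha
    simp only [total_cons, total_nil, add_zero] at h
    linarith
  | cons b l ih =>
    intro y j a hy ha h
    have hp := stabilityHom_pos_iff.mpr ha
    rw [total_cons, map_add, ← add_assoc] at h
    have hy' : 0 < y + stabilityHom θ μ a.1 := by linarith
    rw [mergedCollection, if_pos hy'.le, if_neg hy'.ne', add_zero]
    split_ifs with hd
    · simp
    · rw [ih _ _ _ hy'.le (ha.trans_le (not_lt.mp hd)) h]
      simp

/-- A negative offset forbids outer cuts, so the slope must descend; it stays below μ and the offset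
can never return to 0. -/
theorem mergedCollection_eq_zero_of_neg (θ : Fin r → ℝ) (μ : ℝ) (l : List (S r)) :
    ∀ (y : ℝ) (j : ℕ) (a : S r), y ≤ 0 → slope θ a < μ →
      y + stabilityHom θ μ (total (a :: l)) = 0 → mergedCollection θ μ y j (a :: l) = 0 := by
  induction l with
  | nil =>
    intro y j a hy ha h
    have := stabilityHom_neg_iff.mpr ha
    simp only [total_cons, total_nil, add_zero] at h
    linarith
  | cons b l ih =>
    intro y j a hy ha h
    have hp := stabilityHom_neg_iff.mpr ha
    rw [total_cons, map_add, ← add_assoc] at h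
    have hy' : y + stabilityHom θ μ a.1 < 0 := by linarith
    rw [mergedCollection, if_neg hy'.not_ge, add_zero]
    split_ifs with hd
    · exact ih _ _ _ hy'.le (hd.trans ha) h
    · rfl

-- At offset 0 an entry of slope other than μ gives 0 by the two preceding lemmas. An entry of slope
-- μ keeps the offset at 0, so each cut between such entries is an outer cut, contributing a sign
-- and one more zero.
open Classical in
theorem mergedCollection_zero (θ : Fin r → ℝ) (μ : ℝ) (l : List (S r)) :
    ∀ (j : ℕ) (a : S r), stabilityHom θ μ (total (a :: l)) = 0 →
      mergedCollection θ μ 0 j (a :: l) = if slope θ a = μ ∧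
        (a :: l).IsChain (fun a b => slope θ a = slope θ b) then
          (-1 : ℚ) ^ l.length / (j + l.length + 1 : ℚ) else 0 := by
  induction l with
  | nil =>
    intro j a h
    simp only [total_cons, total_nil, add_zero, stabilityHom_eq_zero_iff] at h
    simp [mergedCollection, h]
  | cons b l ih =>
    intro j a h
    rcases lt_trichotomy (slope θ a) μ with ha | ha | ha
    · rw [mergedCollection_eq_zero_of_neg θ μ _ _ _ _ le_rfl ha (by rwa [zero_add]),
        if_neg fun h => ha.ne h.1]
    · have h0 := stabilityHom_eq_zero_iff.mpr ha
      rw [total_cons, map_add, h0, zero_add] at h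
      rw [mergedCollection]
      simp only [h0, add_zero, le_refl, if_true, ih _ _ h, List.isChain_cons_cons, ha,
        true_and]
      by_cases hb : slope θ b = μ
      · simp only [hb, lt_irrefl, if_false, zero_add, true_and]
        split_ifs
        · simp only [List.length_cons, pow_succ]
          push_cast
          ring
        · simp
      · simp [hb, Ne.symm hb]
    · rw [mergedCollection_eq_zero_of_pos θ μ _ _ _ _ le_rfl ha (by rwa [zero_add]),
        if_neg fun h => ha.ne' h.1]

theorem mergedCollection_eq_logCollection (θ : Fin r → ℝ) (γ : S r) {α : List (S r)}
    (hα : α ∈ tuples γ) : mergedCollection θ (slope θ γ) 0 0 α = logCollection θ α := by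
  obtain ⟨a, l, rfl⟩ := List.exists_cons_of_ne_nil (ne_nil_of_mem_tuples hα)
  have h0 : stabilityHom θ (slope θ γ) (total (a :: l)) = 0 := by
    rw [mem_tuples.mp hα, stabilityHom_eq_zero_iff]
  rw [mergedCollection_zero _ _ _ _ _ h0, logCollection]
  -- Entries of a common slope have a sum of the same slope, so the extra condition `slope θ a = μ`
  -- is automatic.
  have key : (a :: l).IsChain (fun a b => slope θ a = slope θ b) → slope θ a = slope θ γ := by
    intro hc
    have hall : ∀ (l : List (S r)) (a : S r),
        (a :: l).IsChain (fun a b => slope θ a = slope θ b) →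
        stabilityHom θ (slope θ a) (total (a :: l)) = 0 := by
      intro l
      induction l with
      | nil =>
        intro a _
        simp [total_cons, total_nil, stabilityHom_eq_zero_iff]
      | cons b l ih =>
        intro a hc
        rw [List.isChain_cons_cons] at hc
        rw [total_cons, map_add, stabilityHom_eq_zero_iff.mpr rfl, zero_add, hc.1]
        exact ih b hc.2
    have := hall l a hc
    rw [mem_tuples.mp hα, stabilityHom_eq_zero_iff] at this
    exact this.symm
  by_cases hc : (a :: l).IsChain (fun a b => slope θ a = slope θ b)
  · simp [hc, key hc]
  · simp [hc]

end Merged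

/-! ### Rational invariants from total invariants -/

section Rational

theorem prod_map_take_mul_drop {r : ℕ} {R : Type*} [Ring R] (X : S r → R) (α : List (S r)) (k : ℕ) :
    ((α.take k).map X).prod * ((α.drop k).map X).prod = (α.map X).prod := by
  rw [← List.prod_append, ← List.map_append, List.take_append_drop]

variable {r : ℕ} {R : Type*} [Ring R] [Algebra ℚ R]

theorem act_smul (c : ℚ) (F : Collection r) (H : S r → R) (γ : S r) :
    act (fun l => c * F l) H γ = c • act F H γ := by
  simp [act, Finset.smul_sum, mul_smul]

theorem act_congr {F G : Collection r} (H : S r → R) {γ : S r}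
    (h : ∀ α ∈ tuples γ, F α = G α) : act F H γ = act G H γ :=
  Finset.sum_congr rfl fun α hα => by rw [h α hα]

open Classical in
/-- The composition of `cutCollection` with the Harder-Narasimhan collection. -/
theorem act_cutCollection_act (θ : Fin r → ℝ) (μ : ℝ) (X : S r → R) (N : ℕ) :
    ∀ (y : ℝ) (j : ℕ) (γ : S r), size γ.1 = N →
      act (cutCollection (stabilityHom θ μ) y j) (act (hnCollection θ) X) γ =
        act (mergedCollection θ μ y j) X γ := by
  induction N using Nat.strong_induction_on with
  | _ N ih =>
  intro y j γ hN
  set A := act (hnCollection θ) X with hA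
  set w : (Fin r → ℕ) → ℚ := fun a => if 0 ≤ y + stabilityHom θ μ a then -1 else 0 with hw
  set z : (Fin r → ℕ) → ℕ := fun a => j + if y + stabilityHom θ μ a = 0 then 1 else 0 with hz
  -- `p.1` is the first outer entry, expanded into a Harder-Narasimhan tuple α; the remainder has
  -- smaller size, so induction applies with the shifted offset.
  have h1 : ∀ p ∈ pairs γ,
      A p.1 * act (fun l => cutCollection (stabilityHom θ μ) y j (p.1 :: l)) A p.2 =
      ∑ α ∈ tuples p.1, ∑ β ∈ tuples p.2,
        (hnCollection θ α * (w (total α) *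
          mergedCollection θ μ (y + stabilityHom θ μ (total α)) (z (total α)) β)) •
          ((α.map X).prod * (β.map X).prod) := by
    intro p hp
    have e : act (fun l => cutCollection (stabilityHom θ μ) y j (p.1 :: l)) A p.2 =
        w p.1.1 • act (mergedCollection θ μ (y + stabilityHom θ μ p.1.1) (z p.1.1)) X p.2 := by
      rw [← ih _ (hN ▸ size_lt_of_mem_pairs hp) _ _ _ rfl, ← act_smul]
      refine act_congr _ fun l hl => ?_
      rw [cutCollection_cons _ _ _ _ (ne_nil_of_mem_tuples hl)]
      simp only [hw, hz]
      split_ifs <;> simp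
    rw [e, hA, act, act, Finset.smul_sum, Finset.sum_mul_sum]
    refine Finset.sum_congr rfl fun α hα => Finset.sum_congr rfl fun β _ => ?_
    rw [mem_tuples.mp hα, smul_smul, smul_mul_smul_comm]
  rw [act_eq_add_pairs, Finset.sum_congr rfl h1, sum_pairs_tuples γ (fun α β =>
        (hnCollection θ α * (w (total α) *
          mergedCollection θ μ (y + stabilityHom θ μ (total α)) (z (total α)) β)) •
          ((α.map X).prod * (β.map X).prod)), cutCollection_singleton, hA, act, act,
    Finset.smul_sum, ← Finset.sum_add_distrib]
  refine Finset.sum_congr rfl fun α hα => ?_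
  simp only [prod_map_take_mul_drop]
  rw [← Finset.sum_smul, smul_smul, ← add_smul,
    mergedCollection_eq_sum θ μ y j (ne_nil_of_mem_tuples hα)]
  congr 2
  · ring
  · refine Finset.sum_congr rfl fun k _ => ?_
    simp only [hw, hz]
    split_ifs <;> simp

/-- The rational invariants in terms of the total invariants, for an arbitrary stability. -/
theorem rational_eq_act_cutCollection (θ : Fin r → ℝ) (A : S r → R) (γ : S r) :
    rational θ A γ = act (cutCollection (stabilityHom θ (slope θ γ)) 0 0) A γ := by
  conv_rhs => rw [← act_hnCollection_stacky θ A]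
  rw [act_cutCollection_act θ _ _ _ _ _ _ rfl, rational]
  exact act_congr _ fun α hα => (mergedCollection_eq_logCollection θ γ hα).symm

end Rational

/-! ### The cycle lemma -/

section Cycle

open Classical in
/-- The inverse of the number of zeros of a multiset of non-negative numbers. -/
noncomputable def zeroWeight (M : Multiset ℝ) : ℚ :=
  if ∀ y ∈ M, 0 ≤ y then 1 / (M.count 0 : ℚ) else 0

/-- Subtracting y leaves only non-negative numbers exactly when y is the minimum; each occurrence of
the minimum then contributes the inverse of its multiplicity. -/
theorem sum_zeroWeight_sub (M : Multiset ℝ) (hM : M ≠ 0) :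
    (M.map fun y => zeroWeight (M.map fun x => x - y)).sum = 1 := by
  classical
  obtain ⟨m, hm, hmin⟩ : ∃ m ∈ M, ∀ x ∈ M, m ≤ x := by
    obtain ⟨m, hm, hmin⟩ := M.toFinset.exists_min_image id
      (by rwa [Multiset.toFinset_nonempty])
    exact ⟨m, Multiset.mem_toFinset.mp hm, fun x hx => hmin x (Multiset.mem_toFinset.mpr hx)⟩
  have key : ∀ y ∈ M, zeroWeight (M.map fun x => x - y) =
      if y = m then 1 / (M.count m : ℚ) else 0 := by
    intro y hy
    have hiff : (∀ z ∈ M.map fun x => x - y, 0 ≤ z) ↔ y = m := by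
      simp only [Multiset.mem_map, forall_exists_index, and_imp, forall_apply_eq_imp_iff₂,
        sub_nonneg]
      exact ⟨fun h => le_antisymm (h m hm) (hmin y hy), fun h => h ▸ hmin⟩
    rw [zeroWeight]
    simp only [hiff]
    split_ifs with h
    · subst h
      rw [← Multiset.count_map_eq_count' (fun x => x - y) M sub_left_injective y, sub_self]
    · rfl
  have hc : (M.count m : ℚ) ≠ 0 := by
    exact_mod_cast (Multiset.count_pos.mpr hm).ne'
  rw [Multiset.map_congr rfl key, Finset.sum_multiset_map_count]
  simp [hm, hc]

variable {r : ℕ}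

/-- The values of `ψ` on `α_{≤k}` for `0 ≤ k < n`. -/
noncomputable def partialSums (ψ : (Fin r → ℕ) →+ ℝ) (α : List (S r)) : Multiset ℝ :=
  (Multiset.range α.length).map fun k => ψ (total (α.take k))

theorem partialSums_append (ψ : (Fin r → ℕ) →+ ℝ) (u v : List (S r)) :
    partialSums ψ (u ++ v) = partialSums ψ u + (partialSums ψ v).map (fun x => x + ψ (total u)) := by
  rw [partialSums, List.length_append, Multiset.range_add, Multiset.map_add, Multiset.map_map,
    partialSums, partialSums, Multiset.map_map]
  congr 1
  · refine Multiset.map_congr rfl fun k hk => ?_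
    rw [List.take_append_of_le_length (Multiset.mem_range.mp hk).le]
  · refine Multiset.map_congr rfl fun k _ => ?_
    simp [List.take_append, total_append, add_comm, List.take_of_length_le]

/-- As the total is 0, partial sums are periodic along the cycle, and a rotation only changes the
base point. -/
theorem partialSums_rotate (ψ : (Fin r → ℕ) →+ ℝ) (u v : List (S r))
    (h : ψ (total (u ++ v)) = 0) :
    partialSums ψ (v ++ u) = (partialSums ψ (u ++ v)).map (fun x => x - ψ (total u)) := by
  rw [total_append, map_add] at h
  rw [partialSums_append, partialSums_append, Multiset.map_add, Multiset.map_map, add_comm]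
  congr 1
  · refine Multiset.map_congr rfl fun x _ => ?_
    linarith
  · simp

theorem sum_zeroWeight_rotate (ψ : (Fin r → ℕ) →+ ℝ) {α : List (S r)} (hα : α ≠ [])
    (h : ψ (total α) = 0) :
    ∑ k ∈ Finset.range α.length, zeroWeight (partialSums ψ (α.drop k ++ α.take k)) = 1 := by
  have hne : partialSums ψ α ≠ 0 := by
    rw [partialSums, ← Multiset.card_pos, Multiset.card_map, Multiset.card_range]
    exact List.length_pos_iff.mpr hα
  rw [← sum_zeroWeight_sub (partialSums ψ α) hne]
  conv_rhs => enter [1, 2]; rw [partialSums]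
  rw [Multiset.map_map, Finset.sum]
  congr 1
  refine Multiset.map_congr rfl fun k _ => ?_
  rw [partialSums_rotate ψ _ _ (by rwa [List.take_append_drop]), List.take_append_drop]
  rfl

theorem cutCollection_eq_zeroWeight (ψ : (Fin r → ℕ) →+ ℝ) {α : List (S r)} (hα : α ≠ []) :
    cutCollection ψ 0 0 α = zeroWeight (partialSums ψ α) * (-1) ^ (α.length - 1) := by
  classical
  have hn := List.length_pos_iff.mpr hα
  have hall : (∀ y ∈ partialSums ψ α, 0 ≤ y) ↔
      ∀ k ∈ Finset.Ico 1 α.length, 0 ≤ 0 + ψ (total (α.take k)) := by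
    simp only [partialSums, Multiset.mem_map, Multiset.mem_range, forall_exists_index, and_imp,
      forall_apply_eq_imp_iff₂, Finset.mem_Ico, zero_add]
    refine ⟨fun h k _ hk => h k hk, fun h k hk => ?_⟩
    rcases Nat.eq_zero_or_pos k with rfl | hk0
    · simp [total_nil]
    · exact h k hk0 hk
  -- The empty prefix k = 0 always contributes a zero: this is the 1 in n_0 + 1.
  have hcount : (partialSums ψ α).count 0 =
      ((Finset.Ico 1 α.length).filter (fun k => 0 + ψ (total (α.take k)) = 0)).card + 1 := by
    have e : (partialSums ψ α).count 0 =
        ((Finset.range α.length).filter (fun k => 0 + ψ (total (α.take k)) = 0)).card := by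
      rw [partialSums, Multiset.count_map]
      simp only [zero_add, eq_comm (a := (0 : ℝ))]
      rfl
    rw [e, Finset.card_filter, Finset.card_filter, Finset.range_eq_Ico,
      Finset.sum_eq_sum_Ico_succ_bot hn]
    simp [total_nil, add_comm]
  rw [cutCollection, zeroWeight]
  simp only [hall, hcount]
  split_ifs
  · push_cast
    ring
  · simp

theorem nonneg_of_zeroWeight_ne_zero {ψ : (Fin r → ℕ) →+ ℝ} {α : List (S r)}
    (h : zeroWeight (partialSums ψ α) ≠ 0) {k : ℕ} (hk : k < α.length) :
    0 ≤ ψ (total (α.take k)) := by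
  rw [zeroWeight] at h
  exact (ite_ne_right_iff.mp h).1 _
    (Multiset.mem_map_of_mem (fun k => ψ (total (α.take k))) (Multiset.mem_range.mpr hk))

end Cycle

/-! ### Comparing a stability with its perturbation -/

section Comparison

variable {r : ℕ} {R : Type*} [Ring R] [Algebra ℚ R]

/-- If `ψ'` refines `ψ`, the two cut collections give the same value at `γ`, provided that the
products of complementary tuples in the kernel of `ψ` commute. -/
theorem act_cutCollection_eq (ψ ψ' : (Fin r → ℕ) →+ ℝ) (γ : S r) (h0 : ψ γ.1 = 0)
    (h0' : ψ' γ.1 = 0) (hpos : ∀ a ≤ γ.1, 0 < ψ a → 0 < ψ' a) (A : S r → R)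
    (hA : ∀ u v : List (S r), u ≠ [] → v ≠ [] → total u + total v = γ.1 → ψ (total u) = 0 →
      Commute (u.map A).prod (v.map A).prod) :
    act (cutCollection ψ' 0 0) A γ = act (cutCollection ψ 0 0) A γ := by
  set p : List (S r) → ℚ := fun α => zeroWeight (partialSums ψ α) with hp
  set p' : List (S r) → ℚ := fun α => zeroWeight (partialSums ψ' α) with hp'
  set B : List (S r) → R := fun α => (-1 : ℚ) ^ (α.length - 1) • (α.map A).prod with hB
  have e : act (cutCollection ψ 0 0) A γ = ∑ α ∈ tuples γ, p α • B α :=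
    Finset.sum_congr rfl fun α hα => by
      rw [cutCollection_eq_zeroWeight _ (ne_nil_of_mem_tuples hα), mul_smul]
  have e' : act (cutCollection ψ' 0 0) A γ = ∑ α ∈ tuples γ, p' α • B α :=
    Finset.sum_congr rfl fun α hα => by
      rw [cutCollection_eq_zeroWeight _ (ne_nil_of_mem_tuples hα), mul_smul]
  have hrange : ∀ α ∈ tuples γ, ∀ f : ℕ → ℚ, ∑ k ∈ Finset.range α.length, f k =
      f 0 + ∑ k ∈ Finset.Ico 1 α.length, f k := fun α hα f => by
    rw [Finset.range_eq_Ico, Finset.sum_eq_sum_Ico_succ_bot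
      (List.length_pos_iff.mpr (ne_nil_of_mem_tuples hα))]
  set φ : List (S r) → List (S r) → R := fun u v => (p (v ++ u) * p' (u ++ v)) • B (u ++ v) with hφ
  -- Multiply by the rotation sum of `p`, which is 1; the diagonal term is the trivial rotation.
  have l1 : ∀ α ∈ tuples γ, p' α • B α = (p α * p' α) • B α +
      ∑ k ∈ Finset.Ico 1 α.length, φ (α.take k) (α.drop k) := by
    intro α hα
    have h1 := sum_zeroWeight_rotate ψ (ne_nil_of_mem_tuples hα)
      (by rw [mem_tuples.mp hα, h0])
    rw [hrange α hα] at h1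
    conv_lhs => rw [← one_mul (p' α), ← h1, add_mul, add_smul, Finset.sum_mul, Finset.sum_smul]
    simp [hφ, hp]
  have l2 : ∀ α ∈ tuples γ, p α • B α = (p α * p' α) • B α +
      ∑ k ∈ Finset.Ico 1 α.length, φ (α.drop k) (α.take k) := by
    intro α hα
    have h1 := sum_zeroWeight_rotate ψ' (ne_nil_of_mem_tuples hα)
      (by rw [mem_tuples.mp hα, h0'])
    rw [hrange α hα] at h1
    conv_lhs => rw [← mul_one (p α), ← h1, mul_add, add_smul, Finset.mul_sum, Finset.sum_smul]
    congr 1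
    · simp [hp']
    refine Finset.sum_congr rfl fun k hk => ?_
    rw [Finset.mem_Ico] at hk
    simp only [hφ, List.take_append_drop]
    change (p α * p' _) • _ = _
    by_cases hz : p α * p' (α.drop k ++ α.take k) = 0
    · rw [hz, zero_smul, zero_smul]
    obtain ⟨hz1, hz2⟩ := mul_ne_zero_iff.mp hz
    have ht := (total_take_add_total_drop α k).trans (mem_tuples.mp hα)
    have a1 := nonneg_of_zeroWeight_ne_zero hz1 hk.2
    have a2 := nonneg_of_zeroWeight_ne_zero hz2 (k := (α.drop k).length) (by
      simp only [List.length_append, List.length_drop, List.length_take]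
      omega)
    rw [List.take_left] at a2
    have a3 : ψ' (total (α.take k)) + ψ' (total (α.drop k)) = 0 := by
      rw [← map_add, ht, h0']
    -- If ψ(α_{≤k}) > 0, then ψ'(α_{≤k}) > 0, so ψ'(α_{>k}) < 0; but α_{>k} is a prefix of the
    -- rotated tuple, whose ψ'-weight is non-zero.
    have a4 : ψ (total (α.take k)) = 0 := by
      refine le_antisymm (not_lt.mp fun hlt => ?_) a1
      have := hpos _ (by rw [← ht]; exact le_self_add) hlt
      linarith
    have hc := hA (α.take k) (α.drop k)
      (by rw [← List.length_pos_iff, List.length_take]; omega)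
      (by rw [← List.length_pos_iff, List.length_drop]; omega) ht a4
    congr 1
    simp only [hB, List.map_append, List.prod_append]
    rw [← hc.eq, prod_map_take_mul_drop]
    congr 2
    simp only [List.length_append, List.length_drop, List.length_take]
    omega
  rw [e, e', Finset.sum_congr rfl l1, Finset.sum_congr rfl l2, Finset.sum_add_distrib,
    Finset.sum_add_distrib, sum_tuples_swap]

end Comparison

/-! ### Density of generic stabilities -/

section Generic

variable {r : ℕ}

theorem continuous_slope (a : S r) : Continuous fun θ : Fin r → ℝ => slope θ a := by
  unfold slope
  fun_prop

/-- The slopes of non-proportional elements differ on a dense set. -/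
theorem dense_slope_ne {a b : S r} (h : ¬ Proportional a b) :
    Dense {θ : Fin r → ℝ | slope θ a ≠ slope θ b} := by
  have ha := sum_cast_pos a
  have hb := sum_cast_pos b
  let f : (Fin r → ℝ) →ₗ[ℝ] ℝ :=
    { toFun := fun θ => slope θ a - slope θ b
      map_add' := fun x y => by
        simp only [slope, Pi.add_apply, add_mul, Finset.sum_add_distrib]
        ring
      map_smul' := fun c x => by
        simp only [slope, Pi.smul_apply, smul_eq_mul, mul_assoc, ← Finset.mul_sum,
          RingHom.id_apply]
        ring }
  have hset : {θ : Fin r → ℝ | slope θ a ≠ slope θ b} = ((LinearMap.ker f : Set (Fin r → ℝ)))ᶜ := by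
    ext θ
    simp [f, sub_eq_zero]
  rw [hset, ← interior_eq_empty_iff_dense_compl]
  by_contra hne
  have htop := Submodule.eq_top_of_nonempty_interior' (LinearMap.ker f)
    (Set.nonempty_iff_ne_empty.mpr hne)
  -- Equal slopes at every basis vector mean a/|a| = b/|b|; clearing denominators gives the
  -- multipliers.
  refine h ⟨size b.1, size a.1, size_pos b, size_pos a, funext fun k => ?_⟩
  have hk : f (Pi.single k 1) = 0 := by
    rw [← LinearMap.mem_ker, htop]
    trivial
  have e : ∀ c : S r, slope (Pi.single k 1) c = (c.1 k : ℝ) / ∑ i, (c.1 i : ℝ) := by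
    intro c
    simp [slope, Pi.single_apply]
  change slope (Pi.single k 1) a - slope (Pi.single k 1) b = 0 at hk
  rw [e, e, sub_eq_zero, div_eq_div_iff ha.ne' hb.ne'] at hk
  simp only [Pi.smul_apply, smul_eq_mul, size]
  have : (a.1 k) * ∑ i, b.1 i = b.1 k * ∑ i, a.1 i := by exact_mod_cast hk
  linarith

/-- Baire's theorem: one open dense condition for each of countably many pairs. -/
theorem dense_genericStabilities (r : ℕ) : Dense (genericStabilities r) := by
  have e : genericStabilities r = ⋂ p ∈ {p : S r × S r | ¬ Proportional p.1 p.2},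
      {θ : Fin r → ℝ | slope θ p.1 ≠ slope θ p.2} := by
    ext θ
    simp only [genericStabilities, Set.mem_ofPred_eq, Set.mem_iInter, Prod.forall, ne_eq]
    exact ⟨fun h a b => mt (h a b), fun h a b hab => by_contra fun hn => h a b hn hab⟩
  rw [e]
  refine dense_biInter_of_isOpen (fun p _ => ?_) (Set.to_countable _)
    (fun p hp => dense_slope_ne hp)
  exact isOpen_ne_fun (continuous_slope _) (continuous_slope _)

end Generic

/-! ### The self-stability and the attractor collection -/

section Attractor

variable {r : ℕ} (ω : LinearMap.BilinForm ℤ (Fin r → ℤ))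

theorem neBot_attractorFilter (γ : S r) : (attractorFilter ω γ).NeBot :=
  mem_closure_iff_nhdsWithin_neBot.mp (dense_genericStabilities r _)

theorem toLattice_add (a b : Fin r → ℕ) : toLattice (a + b) = toLattice a + toLattice b := by
  funext i
  simp [toLattice]

theorem stabilityHom_selfStability (γ : S r) (a : Fin r → ℕ) :
    stabilityHom (selfStability ω γ) 0 a = (ω (toLattice a) (toLattice γ.1) : ℤ) := by
  have e : toLattice a = ∑ k, (a k : ℤ) • (Pi.single k 1 : Fin r → ℤ) := by
    funext i
    simp [toLattice, Finset.sum_apply, Pi.single_apply]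
  rw [e, map_sum, LinearMap.sum_apply, stabilityHom_apply, Int.cast_sum]
  refine Finset.sum_congr rfl fun k _ => ?_
  rw [map_smul, LinearMap.smul_apply, sub_zero, smul_eq_mul, Int.cast_mul, Int.cast_natCast,
    mul_comm]
  rfl

variable {ω}

theorem form_self_eq_zero (hω : ∀ a b, ω a b = -ω b a) (a : Fin r → ℤ) : ω a a = 0 := by
  have := hω a a
  omega

theorem slope_selfStability (hω : ∀ a b, ω a b = -ω b a) (γ : S r) :
    slope (selfStability ω γ) γ = 0 := by
  rw [← stabilityHom_eq_zero_iff, stabilityHom_selfStability, form_self_eq_zero hω, Int.cast_zero]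

theorem form_total_left (hω : ∀ a b, ω a b = -ω b a) {γ a b : Fin r → ℕ} (h : a + b = γ) :
    ω (toLattice a) (toLattice γ) = ω (toLattice a) (toLattice b) := by
  rw [← h, toLattice_add, map_add, form_self_eq_zero hω, zero_add]

/-- Skew-symmetry gives γ slope 0 and lets α_{>k} be replaced by γ in each cut pairing, making it
linear in α_{≤k}. -/
theorem attractorCollection_eq_cutCollection (hω : ∀ a b, ω a b = -ω b a) (γ : S r)
    {α : List (S r)} (hα : α ∈ tuples γ) :
    attractorCollection ω α = cutCollection (stabilityHom (selfStability ω γ) 0) 0 0 α := by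
  have key : ∀ k, 0 + stabilityHom (selfStability ω γ) 0 (total (α.take k)) =
      (cutPairing ω α k : ℝ) := by
    intro k
    rw [zero_add, stabilityHom_selfStability, cutPairing, form_total_left hω
      ((total_take_add_total_drop α k).trans (mem_tuples.mp hα))]
  simp only [attractorCollection, cutCollection, key, Int.cast_nonneg_iff, Int.cast_eq_zero,
    Nat.cast_zero, add_zero]
  congr

/-- A stability close to the self-stability of `γ` has the same positive elements below `γ`. -/
theorem eventually_stabilityHom_pos (hω : ∀ a b, ω a b = -ω b a) (γ : S r) :
    ∀ᶠ θ in 𝓝 (selfStability ω γ), ∀ a ≤ γ.1, 0 < stabilityHom (selfStability ω γ) 0 a →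
      0 < stabilityHom θ (slope θ γ) a := by
  refine (Filter.eventually_all_finite (Set.finite_Iic γ.1)).mpr fun a _ => ?_
  by_cases h : 0 < stabilityHom (selfStability ω γ) 0 a
  · have hc : Continuous fun θ : Fin r → ℝ => stabilityHom θ (slope θ γ) a := by
      have := continuous_slope γ
      simp only [stabilityHom_apply]
      fun_prop
    have := (hc.tendsto (selfStability ω γ)).eventually_const_lt (u := 0)
      (by rwa [slope_selfStability hω])
    exact this.mono fun θ hθ _ => hθ
  · exact Filter.Eventually.of_forall fun θ h' => absurd h' h

variable {R : Type*} [Ring R] [Algebra ℚ R]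

theorem prod_map_mem (𝒜 : (Fin r → ℕ) → Submodule ℚ R) [GradedAlgebra 𝒜] (A : S r → R)
    (hA : ∀ γ, A γ ∈ 𝒜 γ.1) (α : List (S r)) : (α.map A).prod ∈ 𝒜 (total α) :=
  SetLike.list_prod_map_mem_graded α Subtype.val A fun a _ => hA a

theorem eventually_rational_eq (𝒜 : (Fin r → ℕ) → Submodule ℚ R) [GradedAlgebra 𝒜]
    (hω : ∀ a b, ω a b = -ω b a)
    (hcomm : ∀ γ γ' : S r, ω (toLattice γ.1) (toLattice γ'.1) = 0 →
      ∀ x ∈ 𝒜 γ.1, ∀ y ∈ 𝒜 γ'.1, Commute x y)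
    (A : S r → R) (hA : ∀ γ, A γ ∈ 𝒜 γ.1) (γ : S r) :
    ∀ᶠ θ in 𝓝 (selfStability ω γ), rational θ A γ = act (attractorCollection ω) A γ := by
  filter_upwards [eventually_stabilityHom_pos hω γ] with θ hθ
  rw [rational_eq_act_cutCollection,
    act_congr A fun α hα => attractorCollection_eq_cutCollection hω γ hα]
  refine act_cutCollection_eq _ _ γ ?_ ?_ hθ A fun u v hu hv huv h => ?_
  · rw [stabilityHom_eq_zero_iff, slope_selfStability hω]
  · rw [stabilityHom_eq_zero_iff]
  · rw [stabilityHom_selfStability, form_total_left hω huv, Int.cast_eq_zero] at h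
    exact hcomm ⟨_, total_ne_zero hu⟩ ⟨_, total_ne_zero hv⟩ h _ (prod_map_mem 𝒜 A hA u) _
      (prod_map_mem 𝒜 A hA v)

end Attractor

end AttractorDT

theorem mainTheorem3 {r : ℕ} {R : Type*} [Ring R] [Algebra ℚ R]
    (𝒜 : (Fin r → ℕ) → Submodule ℚ R) [GradedAlgebra 𝒜]
    (ω : LinearMap.BilinForm ℤ (Fin r → ℤ))
    (hω : ∀ a b, ω a b = -ω b a)
    (hcomm : ∀ γ γ' : AttractorDT.S r,
      ω (AttractorDT.toLattice γ.1) (AttractorDT.toLattice γ'.1) = 0 →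
        ∀ x ∈ 𝒜 γ.1, ∀ y ∈ 𝒜 γ'.1, Commute x y)
    (A : AttractorDT.S r → R) (hA : ∀ γ, A γ ∈ 𝒜 γ.1) :
    (∀ γ : AttractorDT.S r, (AttractorDT.attractorFilter ω γ).NeBot ∧
      ∀ᶠ θ' in AttractorDT.attractorFilter ω γ,
        AttractorDT.rational θ' A γ = AttractorDT.attractorRational ω A γ) ∧
    AttractorDT.attractorRational ω A =
      AttractorDT.act (AttractorDT.attractorCollection ω) A := by
  have hev : ∀ γ, ∀ᶠ θ' in AttractorDT.attractorFilter ω γ, AttractorDT.rational θ' A γ =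
      AttractorDT.act (AttractorDT.attractorCollection ω) A γ := fun γ =>
    (AttractorDT.eventually_rational_eq 𝒜 hω hcomm A hA γ).filter_mono nhdsWithin_le_nhds
  have heq : AttractorDT.attractorRational ω A =
      AttractorDT.act (AttractorDT.attractorCollection ω) A := by
    funext γ
    have hex : ∃ x : R, ∀ᶠ θ' in AttractorDT.attractorFilter ω γ,
        AttractorDT.rational θ' A γ = x := ⟨_, hev γ⟩
    have := AttractorDT.neBot_attractorFilter ω γ
    rw [AttractorDT.attractorRational, dif_pos hex]
    -- The filter is proper, so some generic θ attains both eventual values.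
    obtain ⟨θ, h1, h2⟩ := (hex.choose_spec.and (hev γ)).exists
    exact h1.symm.trans h2
  exact ⟨fun γ => ⟨AttractorDT.neBot_attractorFilter ω γ, by rw [heq]; exact hev γ⟩, heq⟩
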